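/- Conventions. $\mathcal A\subseteq M_n(\mathbb C)$ and $\mathcal B\subseteq M_m(\mathbb C)$ denote unital $*$-subalgebras, with the matrix trace $\mathrm{Tr}$ and the Hilbert--Schmidt inner product $\langle a,b\rangle=\mathrm{Tr}\,a^*b$; density operators are positive elements of trace $1$. A linear map $\Phi$ is a unital Schwarz map if $\Phi(I)=I$ and $\Phi(a^*a)\ge\Phi(a)^*\Phi(a)$ for all $a$. For linear $T:\mathcal A\to\mathcal B$, $T^*$ is the Hilbert--Schmidt adjoint and $T_\rho(b)=T(\rho)^{-1/2}T(\rho^{1/2}b\rho^{1/2})T(\rho)^{-1/2}$. $T$ is reversible for a set $\mathcal S$ of density operators if there is a linear $S:\mathcal B\to\mathcal A$ with $S^*$ a unital Schwarz map and $S(T(\tau))=\tau$ for all $\tau\in\mathcal S$. For $f:[0,\infty)\to\mathbb R$ and $\mathrm{supp}\,\sigma\le\mathrm{supp}\,\rho$ the $f$-divergence is $S_f(\sigma,\rho)=\langle\rho^{1/2},f(\Delta_{\sigma,\rho})\rho^{1/2}\rangle$, where $\Delta_{\sigma,\rho}(a)=\sigma a\rho^{-1}$ on $\mathcal A$; $L_\sigma$,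 $R_\rho$ are left and right multiplication. The setting (C) for $(T,\mathcal S,\rho)$ is: $\mathcal S$ is a set of density operators, $\rho\in\mathcal S$ is invertible, $T(\rho)$ is invertible, and both $T^*$ and $T_\rho$ are unital Schwarz maps. Let $f(x)=(1+x)^{-1}$, $x\ge0$. (1) $f$ is operator convex, and strictly so: for positive matrices $a,b$ and $0<t<1$, $f(ta+(1-t)b)=tf(a)+(1-t)f(b)$ only if $a=b$. The Dirac measure $\mu=\delta_1$ is the one and only nonnegative measure $\mu$ on $(0,\infty)$ with $\int(1+t)^{-2}d\mu(t)<\infty$ for which there are $a\in\mathbb R$, $b\ge0$ such that $f(x)=f(0)+ax+bx^2+\int_{(0,\infty)}\bigl(\frac{x}{1+t}-\frac{x}{x+t}\bigr)d\mu(t)$ for all $x\ge 0$. (2) For density operators $\sigma,\rho\in\mathcal A$ with $\rho$ invertible, $L_\sigma+R_\rho$ is invertible on $\mathcal A$ and $S_f(\sigma,\rho)=\mathrm{Tr}\,\rho\,(L_\sigma+R_\rho)^{-1}(\rho)$. (3) Let $\sigma\in\mathcal A$ be an invertible density operator and $p\in\mathcal A$ a projection with $\sigma p\ne p\sigma$ and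 $\lambda:=\mathrm{Tr}\,p\sigma\ne\frac12$. Let $\mathcal B\subseteq\mathcal A$ be the subalgebra generated by $p$ (and $I$). Then $\mathcal B$ is abelian, and there is exactly one trace preserving conditional expectation $T:\mathcal A\to\mathcal B$ (positive linear map with $T(bac)=bT(a)c$ for $a\in\mathcal A$, $b,c\in\mathcal B$, and $\mathrm{Tr}\,T(a)=\mathrm{Tr}\,a$); $T(\sigma)$ is the density of the restriction of $\sigma$ to $\mathcal B$, i.e. $\mathrm{Tr}\,T(\sigma)b=\mathrm{Tr}\,\sigma b$ for $b\in\mathcal B$. Put $x:=(1-\lambda)p+\lambda(I-p)\in\mathcal B$ and $\rho:=(I-x)^{-1}\sigma x$. Then $0<\lambda<1$, $I-x$ is invertible, $\rho=\frac1{\lambda(1-\lambda)}x\sigma x$, $\rho$ is an invertible density operator, $T(\rho)=(I-x)^{-1}T(\sigma)x$, and (C) holds for $T$, $\mathcal S=\{\sigma,\rho\}$ and $\rho$. Moreover $L_{T(\sigma)}+R_{T(\rho)}$ is invertible on $\mathcal B$, $$(L_\sigma+R_\rho)^{-1}(\rho)=x=(L_{T(\sigma)}+R_{T(\rho)})^{-1}(T(\rho)),\qquad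 S_f(T(\sigma),T(\rho))=S_f(\sigma,\rho),$$ but $T$ is not reversible for $\{\sigma,\rho\}$. (4) For every $n\ge2$ there are $\sigma,p\in\mathcal A=M_n(\mathbb C)$ as in (3). (5) Consequently, in the setting (C), the equality $S_f(T(\tau),T(\rho))=S_f(\tau,\rho)$ for all $\tau\in\mathcal S$ does not in general imply that $T$ is reversible for $\mathcal S$, although $f$ is strictly operator convex. Hence, in the criterion that $T$ is reversible for $\mathcal S$ whenever such an equality holds for an operator convex function whose representing measure has sufficiently many support points, the support condition cannot be removed. -/

import Mathlib

open MeasureTheory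
open scoped ComplexOrder

noncomputable section

namespace QRev

abbrev Mat (n : ℕ) : Type := Matrix (Fin n) (Fin n) ℂ

/-- The (unital) C*-subalgebras of `B(ℂⁿ)`. -/
abbrev Alg (n : ℕ) : Type := StarSubalgebra ℂ (Mat n)

/-! ### Operator convexity and integral representations -/

/-- `f : [0,∞) → ℝ` is operator convex: the convexity inequality holds in the Loewner order for
positive semidefinite complex matrices of every size (values of `f` at negative reals are
irrelevant). -/
def OperatorConvex (f : ℝ → ℝ) : Prop :=
  ∀ (k : ℕ) (a b : Mat k), a.PosSemidef → b.PosSemidef → ∀ t : ℝ, 0 ≤ t → t ≤ 1 →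
    (t • cfc f a + (1 - t) • cfc f b - cfc f (t • a + (1 - t) • b)).PosSemidef

/-- Operator convex, with equality in the convexity inequality only in the trivial cases. -/
def StrictlyOperatorConvex (f : ℝ → ℝ) : Prop :=
  OperatorConvex f ∧
    ∀ (k : ℕ) (a b : Mat k), a.PosSemidef → b.PosSemidef → ∀ t : ℝ, 0 < t → t < 1 →
      cfc f (t • a + (1 - t) • b) = t • cfc f a + (1 - t) • cfc f b → a = b

/-- `μ` is a nonnegative measure on `(0,∞)` with `∫ (1+t)⁻² dμ < ∞` and
`f x = f 0 + a x + b x² + ∫ (x/(1+t) - x/(x+t)) dμ(t)` on `[0,∞)`, for some real `a` and some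
`b ≥ 0`. -/
structure IsRepresentingMeasure (f : ℝ → ℝ) (μ : Measure ℝ) : Prop where
  null : μ (Set.Iic 0) = 0
  finite : ∫⁻ t in Set.Ioi 0, ENNReal.ofReal (((1 + t) ^ 2)⁻¹) ∂μ < ⊤
  repr : ∃ a b : ℝ, 0 ≤ b ∧ ∀ x : ℝ, 0 ≤ x →
    f x = f 0 + a * x + b * x ^ 2 + ∫ t in Set.Ioi 0, (x / (1 + t) - x / (x + t)) ∂μ

variable {n m : ℕ}

/-! ### States, powers -/

/-- Density operators in `A` (with respect to the trace of `Mₙ(ℂ)`). -/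
structure IsDensity {A : Alg n} (a : A) : Prop where
  pos : (a : Mat n).PosSemidef
  trace_eq : (a : Mat n).trace = 1

theorem cfc_mem_alg (A : Alg n) (f : ℝ → ℝ) (a : A) : cfc f (a : Mat n) ∈ A := by
  have hc : IsClosed (A : Set (Mat n)) :=
    (Subalgebra.toSubmodule A.toSubalgebra).closed_of_finiteDimensional
  exact cfc_mem (hs := hc) f a.2

/-- The real power `a ^ s` of a positive element `a` of `A` (for `s < 0` the generalized inverse
power, since `(0 : ℝ) ^ s = 0` for `s ≠ 0`). -/
def pow {A : Alg n} (a : A) (s : ℝ) : A :=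
  ⟨cfc (fun x : ℝ => x ^ s) (a : Mat n), cfc_mem_alg A _ a⟩

/-! ### The Hilbert--Schmidt space of an algebra -/

/-- `A` as a Hilbert space, with the Hilbert--Schmidt inner product `⟨a, b⟩ = Tr a* b`. -/
def HS (A : Alg n) : Type := A

instance (A : Alg n) : AddCommGroup (HS A) := inferInstanceAs (AddCommGroup A)

instance (A : Alg n) : Module ℂ (HS A) := inferInstanceAs (Module ℂ A)

/-- The identity map from `A` to its Hilbert space. -/
def toHS {A : Alg n} : A ≃ₗ[ℂ] HS A := LinearEquiv.refl ℂ A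

/-- The underlying matrix. -/
def HS.mat {A : Alg n} (a : HS A) : Mat n := (toHS.symm a : Mat n)

instance hsCore (A : Alg n) : InnerProductSpace.Core ℂ (HS A) where
  inner a b := (star a.mat * b.mat).trace
  conj_inner_symm a b := by
    rw [starRingEnd_apply, Matrix.star_eq_conjTranspose, Matrix.star_eq_conjTranspose,
      ← Matrix.trace_conjTranspose]
    simp
  re_inner_nonneg a := by
    have h := (Matrix.posSemidef_conjTranspose_mul_self a.mat).trace_nonneg
    exact (Complex.le_def.1 h).1
  add_left a b c := by
    change (star (a.mat + b.mat) * c.mat).trace = _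
    simp [star_add, add_mul, Matrix.trace_add]
  smul_left a b r := by
    change (star (r • a.mat) * b.mat).trace = _
    simp [star_smul, Matrix.trace_smul]
  definite a h := by
    have h' : a.mat = 0 := Matrix.trace_conjTranspose_mul_self_eq_zero_iff.1 h
    exact Subtype.ext h'

instance (A : Alg n) : NormedAddCommGroup (HS A) :=
  InnerProductSpace.Core.toNormedAddCommGroup (𝕜 := ℂ)

instance (A : Alg n) : InnerProductSpace ℂ (HS A) :=
  InnerProductSpace.ofCore (hsCore A).toCore

instance (A : Alg n) : FiniteDimensional ℂ (HS A) :=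
  inferInstanceAs (FiniteDimensional ℂ (Subalgebra.toSubmodule A.toSubalgebra))

instance (A : Alg n) : CompleteSpace (HS A) := FiniteDimensional.complete ℂ (HS A)

theorem HS.inner_eq {A : Alg n} (a b : HS A) :
    inner ℂ a b = (star a.mat * b.mat).trace := rfl

/-- The Hilbert--Schmidt adjoint `T* : B → A` of a linear map `T : A → B`. -/
def hsAdjoint {A : Alg n} {B : Alg m} (T : A →ₗ[ℂ] B) : B →ₗ[ℂ] A :=
  toHS.symm.toLinearMap ∘ₗ
    LinearMap.adjoint (toHS.toLinearMap ∘ₗ T ∘ₗ toHS.symm.toLinearMap : HS A →ₗ[ℂ] HS B) ∘ₗ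
    toHS.toLinearMap

theorem hsAdjoint_spec {A : Alg n} {B : Alg m} (T : A →ₗ[ℂ] B) (a : A) (b : B) :
    (star (T a : Mat m) * (b : Mat m)).trace = (star (a : Mat n) * (hsAdjoint T b : Mat n)).trace :=
  (LinearMap.adjoint_inner_right
    (toHS.toLinearMap ∘ₗ T ∘ₗ toHS.symm.toLinearMap : HS A →ₗ[ℂ] HS B) (toHS a) (toHS b)).symm

/-! ### `f`-divergences -/

/-- The relative modular operator `Δ_{σ,ρ} : a ↦ σ a ρ⁻¹` on the Hilbert space `A`. -/
def relModular {A : Alg n} (σ ρ : A) : HS A →L[ℂ] HS A :=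
  LinearMap.toContinuousLinearMap (toHS.conj (LinearMap.mulLeftRight ℂ (σ, pow ρ (-1))))

/-- The `f`-divergence `S_f(σ, ρ) = ⟨ρ^{1/2}, f(Δ_{σ,ρ}) ρ^{1/2}⟩`, for density operators with
`supp σ ≤ supp ρ`; here `f(Δ_{σ,ρ})` is the functional calculus of the positive operator
`Δ_{σ,ρ}` on the Hilbert space `A`. -/
def fDivergence (f : ℝ → ℝ) {A : Alg n} (σ ρ : A) : ℝ :=
  (inner ℂ (toHS (pow ρ (1 / 2))) (cfc f (relModular σ ρ) (toHS (pow ρ (1 / 2))))).re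

/-- The operator `L_σ + R_ρ : a ↦ σ a + a ρ` on `A`. -/
def leftAddRight {A : Alg n} (σ ρ : A) : Module.End ℂ A :=
  LinearMap.mulLeft ℂ σ + LinearMap.mulRight ℂ ρ

/-! ### Schwarz maps, the dual map, reversibility -/

/-- Unital maps with `Φ(a* a) ≥ Φ(a)* Φ(a)`. -/
structure IsUnitalSchwarz {A : Alg n} {B : Alg m} (Φ : A →ₗ[ℂ] B) : Prop where
  unital : Φ 1 = 1
  schwarz : ∀ a : A, ((Φ (star a * a) - star (Φ a) * Φ a : B) : Mat m).PosSemidef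

/-- `T_ρ(b) = T(ρ)^{-1/2} T(ρ^{1/2} b ρ^{1/2}) T(ρ)^{-1/2}`. -/
def dualMap {A : Alg n} {B : Alg m} (T : A →ₗ[ℂ] B) (ρ : A) : A →ₗ[ℂ] B :=
  LinearMap.mulLeftRight ℂ (pow (T ρ) (-(1 / 2)), pow (T ρ) (-(1 / 2))) ∘ₗ T ∘ₗ
    LinearMap.mulLeftRight ℂ (pow ρ (1 / 2), pow ρ (1 / 2))

/-- `T` is reversible for `𝒮`: there is `S : B → A` with `S*` a unital Schwarz map and
`S (T τ) = τ` for all `τ ∈ 𝒮`. -/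
def Reversible {A : Alg n} {B : Alg m} (T : A →ₗ[ℂ] B) (𝒮 : Set A) : Prop :=
  ∃ S : B →ₗ[ℂ] A, IsUnitalSchwarz (hsAdjoint S) ∧ ∀ τ ∈ 𝒮, S (T τ) = τ

/-- The setting of the reversibility criteria: `𝒮` is a set of density operators containing the
invertible element `ρ`, `T ρ` is invertible, and both `T*` and `T_ρ` are unital Schwarz maps. -/
structure ReversibilitySetting {A : Alg n} {B : Alg m} (T : A →ₗ[ℂ] B) (𝒮 : Set A) (ρ : A) :
    Prop where
  density : ∀ τ ∈ 𝒮, IsDensity τ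
  mem : ρ ∈ 𝒮
  isUnit : IsUnit ρ
  isUnit_map : IsUnit (T ρ)
  adjoint_schwarz : IsUnitalSchwarz (hsAdjoint T)
  dual_schwarz : IsUnitalSchwarz (dualMap T ρ)

/-! ### The conditional expectation onto the algebra generated by a projection -/

/-- Trace preserving conditional expectations of `A` onto a subalgebra `B ⊆ A`: positive,
`E (b a c) = b E(a) c` for `a ∈ A` and `b, c ∈ B`, and `Tr E(a) = Tr a`. -/
structure IsTracePreservingCondExp {A B : Alg n} (h : B ≤ A) (E : A →ₗ[ℂ] B) : Prop where
  pos : ∀ a : A, (a : Mat n).PosSemidef → (E a : Mat n).PosSemidef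
  bimodule : ∀ (a : A) (b c : B),
    E (StarSubalgebra.inclusion h b * a * StarSubalgebra.inclusion h c) = b * E a * c
  trace_eq : ∀ a : A, (E a : Mat n).trace = (a : Mat n).trace

/-- The subalgebra generated by (the identity and) `p`. -/
def genBy {A : Alg n} (p : A) : Alg n := StarAlgebra.adjoin ℂ {(p : Mat n)}

theorem genBy_le {A : Alg n} (p : A) : genBy p ≤ A :=
  StarAlgebra.adjoin_le (by simp)

/-- `p` as an element of the subalgebra that it generates. -/
def genBy.gen {A : Alg n} (p : A) : genBy p :=
  ⟨p, StarAlgebra.subset_adjoin ℂ _ (Set.mem_singleton _)⟩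

/-- `(1 - l) p + l (1 - p)`. -/
def exX {A : Alg n} (p : A) (l : ℝ) : A := (1 - l : ℂ) • p + (l : ℂ) • (1 - p)

/-- `ρ = (1 - x)⁻¹ σ x` with `x = (1 - l) p + l (1 - p)`. -/
def exRho {A : Alg n} (σ p : A) (l : ℝ) : A := Ring.inverse (1 - exX p l) * σ * exX p l

/-- The function `(1 + x)⁻¹`. -/
def exF (x : ℝ) : ℝ := (1 + x)⁻¹

end QRev

end

open QRev

namespace QRev

/-! ### The representing measure of `(1 + x)⁻¹` -/

/-! The counterexample rests on the fact that for `exF` the divergence depends on `(σ, ρ)` only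
through `ρ` and the solution `x` of the linear equation `σ x + x ρ = ρ`. Indeed `1 + Δ` is `L_σ +
R_ρ` followed by right multiplication by `ρ⁻¹`, so the divergence is `Tr ρ x`. If `x` can be chosen
inside the small algebra, nothing is lost by applying `T`. Solving the equation for `ρ` gives `ρ =
(1 - x)⁻¹ σ x`. For `x = (1 - l) p + l (1 - p)` one has `x (1 - x) = l (1 - l)`, so this is a
multiple of `x σ x`. It is positive, and `l = Tr p σ` makes its trace `1`. The bimodule property
gives `T ρ` the same form with `T σ` in place of `σ`, so the same `x` solves the equation in the
small algebra and both divergences equal `Tr ρ x` (`leftAddRight_exX`, `map_exRho`,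
`fDivergence_exF`).

Reversibility fails by positivity. A recovery map `S` is linear and sends `T σ`, `T ρ` to `σ`, `ρ`.
For `l ≠ 1/2` this determines the image of the positive element `p T(σ)`, namely `l (p σ + σ p) + (1
- 2 l) p σ p`. Its corner under `1 - p` is zero, so positivity would kill its off-diagonal blocks,
and `σ` would commute with `p` (`not_reversible`, `commute_of_forall_nonneg`).

Setting (C) is soft: `T*` is the inclusion, and `T_ρ` is a unital positive map into an abelian
algebra (`isUnitalSchwarz_of_pos`). Strict convexity comes from an exact formula for the convexity
defect (`sum_conj_eq_convexity_defect`). Uniqueness of the measure comes from a combination of four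
values of the representation that integrates `(t - 1)²` times a positive function. -/

theorem integrableOn_stieltjes_kernel {μ : Measure ℝ}
    (h : ∫⁻ t in Set.Ioi 0, ENNReal.ofReal (((1 + t) ^ 2)⁻¹) ∂μ < ⊤) {x : ℝ} (hx : 1 ≤ x) :
    IntegrableOn (fun t : ℝ => ((1 + t) * (x + t))⁻¹) (Set.Ioi 0) μ := by
  have hb : IntegrableOn (fun t : ℝ => ((1 + t) ^ 2)⁻¹) (Set.Ioi 0) μ := by
    refine ⟨by fun_prop, ?_⟩
    rwa [hasFiniteIntegral_iff_ofReal (Filter.Eventually.of_forall fun t => by positivity)]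
  refine Integrable.mono' hb (by fun_prop) ?_
  filter_upwards [ae_restrict_mem measurableSet_Ioi] with t ht
  have ht : 0 < t := ht
  rw [Real.norm_of_nonneg (by positivity), sq]
  gcongr

theorem isRepresentingMeasure_exF_dirac : IsRepresentingMeasure exF (Measure.dirac 1) where
  null := by simp
  finite := by
    rw [restrict_dirac' measurableSet_Ioi, if_pos (Set.mem_Ioi.2 one_pos), lintegral_dirac]
    exact ENNReal.ofReal_lt_top
  repr := by
    refine ⟨-1 / 2, 0, le_rfl, fun x hx => ?_⟩
    rw [restrict_dirac' measurableSet_Ioi]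
    simp only [Set.mem_Ioi, zero_lt_one, if_true, integral_dirac, exF]
    have : x + 1 ≠ 0 := by positivity
    have : 1 + x ≠ 0 := by positivity
    field_simp
    ring

theorem IsRepresentingMeasure.eq_dirac {μ : Measure ℝ} (h : IsRepresentingMeasure exF μ) :
    μ = Measure.dirac 1 := by
  obtain ⟨hnull, hfin, a, b, hb, hrep⟩ := h
  let k : ℝ → ℝ → ℝ := fun x t => ((1 + t) * (x + t))⁻¹
  have hk (x : ℝ) (hx : 1 ≤ x) : IntegrableOn (k x) (Set.Ioi 0) μ :=
    integrableOn_stieltjes_kernel hfin hx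
  have hrep' (x : ℝ) (hx : 1 ≤ x) :
      (1 + x)⁻¹ = 1 + a * x + b * x ^ 2 + x * (x - 1) * ∫ t in Set.Ioi 0, k x t ∂μ := by
    have hr := hrep x (by linarith)
    simp only [exF, add_zero, inv_one] at hr
    rw [hr, ← integral_const_mul]
    congr 1
    refine setIntegral_congr_fun measurableSet_Ioi fun t ht => ?_
    have ht : 0 < t := ht
    have : x + t ≠ 0 := by positivity
    have : 1 + t ≠ 0 := by positivity
    simp only [k]
    field_simp
    ring
  have h1 := hrep' 1 le_rfl
  have h2 := hrep' 2 (by norm_num)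
  have h3 := hrep' 3 (by norm_num)
  have h4 := hrep' 4 (by norm_num)
  -- Eliminating `a` by the value at `1` gives `∫ k x = 1 / (2 (1 + x)) - b` for `x = 2, 3, 4`. The
  -- weights are the partial fraction coefficients of `(t - 1)² / ((2 + t)(3 + t)(4 + t))`: they sum
  -- to `1` and cancel the terms `1 / (2 (1 + x))`, leaving `-b`. A nonnegative integral equal to
  -- `-b ≤ 0` forces `b = 0` and `t = 1` almost everywhere.
  have hcomb : ∫ t in Set.Ioi 0, (9 / 2 * k 2 t - 16 * k 3 t + 25 / 2 * k 4 t) ∂μ = -b := by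
    have i2 := (hk 2 (by norm_num)).const_mul (9 / 2)
    have i3 := (hk 3 (by norm_num)).const_mul 16
    have i4 := (hk 4 (by norm_num)).const_mul (25 / 2)
    have e := integral_add (i2.sub i3) i4
    have e' := integral_sub i2 i3
    simp only [Pi.sub_apply] at e
    rw [e, e', integral_const_mul, integral_const_mul, integral_const_mul]
    linarith
  have heq (t : ℝ) (ht : 0 < t) : 9 / 2 * k 2 t - 16 * k 3 t + 25 / 2 * k 4 t =
      (t - 1) ^ 2 / ((1 + t) * (2 + t) * (3 + t) * (4 + t)) := by
    simp only [k]
    field_simp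
    ring
  have hnonneg : 0 ≤ᵐ[μ.restrict (Set.Ioi 0)]
      fun t => 9 / 2 * k 2 t - 16 * k 3 t + 25 / 2 * k 4 t := by
    filter_upwards [ae_restrict_mem measurableSet_Ioi] with t ht
    have ht : 0 < t := ht
    rw [heq t ht]
    simp only [Pi.zero_apply]
    positivity
  have hb0 : b = 0 := by
    have := integral_nonneg_of_ae hnonneg
    linarith
  rw [hb0, neg_zero, integral_eq_zero_iff_of_nonneg_ae hnonneg
    ((((hk 2 (by norm_num)).const_mul _).sub ((hk 3 (by norm_num)).const_mul _)).add
      ((hk 4 (by norm_num)).const_mul _))] at hcomb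
  have hae : ∀ᵐ t ∂μ, t = 1 := by
    rw [Filter.EventuallyEq, ae_restrict_iff' measurableSet_Ioi] at hcomb
    have hpos : ∀ᵐ t ∂μ, 0 < t := by
      rw [ae_iff]
      convert hnull using 2
      ext t
      simp
    filter_upwards [hcomb, hpos] with t ht ht0
    have h := ht ht0
    rw [heq t ht0] at h
    simp only [Pi.zero_apply, div_eq_zero_iff] at h
    rcases h with h | h
    · linarith [pow_eq_zero_iff (two_ne_zero) |>.1 h]
    · exact absurd h (by positivity)
  have hcompl : μ {1}ᶜ = 0 := by
    rw [ae_iff] at hae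
    exact hae
  -- With all mass at `1`, where `k 2` equals `1/6`, the representation at `x = 2` fixes the mass.
  have hint : ∫ t in Set.Ioi 0, k 2 t ∂μ = μ.real {1} / 6 := by
    rw [setIntegral_congr_set (t := {1}), integral_singleton]
    · simp only [k, smul_eq_mul]
      ring
    · filter_upwards [hae] with t ht
      subst ht
      exact propext ⟨fun _ => rfl, fun _ => zero_lt_one (α := ℝ)⟩
  have hone : μ {1} = 1 := by
    have h : μ.real {1} = 1 := by
      rw [hint] at h2
      linarith
    rw [Measure.real, ENNReal.toReal_eq_one_iff] at h
    exact h
  refine Measure.ext fun s hs => ?_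
  rw [Measure.dirac_apply' _ hs]
  by_cases h : (1 : ℝ) ∈ s
  · rw [Set.indicator_of_mem h, Pi.one_apply, ← hone]
    refine le_antisymm ?_ (measure_mono (Set.singleton_subset_iff.2 h))
    calc μ s ≤ μ ({1} ∪ {1}ᶜ) := measure_mono (by simp)
      _ ≤ μ {1} + μ {1}ᶜ := measure_union_le _ _
      _ = μ {1} := by rw [hcompl, add_zero]
  · rw [Set.indicator_of_notMem h]
    exact measure_mono_null (fun t ht => by rintro rfl; exact h ht) hcompl

theorem isRepresentingMeasure_exF_iff (μ : Measure ℝ) :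
    IsRepresentingMeasure exF μ ↔ μ = Measure.dirac 1 :=
  ⟨IsRepresentingMeasure.eq_dirac, fun h => h ▸ isRepresentingMeasure_exF_dirac⟩

/-! ### Operator convexity of `(1 + x)⁻¹` -/

/-- The generality in `R` serves two uses: matrices, for operator convexity, and operators on `HS
A`, for the divergence. -/
theorem cfc_exF_eq_inverse {R : Type*} [Ring R] [StarRing R] [TopologicalSpace R] [Algebra ℝ R]
    [ContinuousFunctionalCalculus ℝ R IsSelfAdjoint] {a : R} (ha : IsSelfAdjoint a)
    (hs : ∀ x ∈ spectrum ℝ a, 0 ≤ x) : IsUnit (1 + a) ∧ cfc exF a = Ring.inverse (1 + a) := by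
  have hne : ∀ x ∈ spectrum ℝ a, 1 + x ≠ 0 := fun x hx => by linarith [hs x hx]
  have h1 : cfc (fun x : ℝ => 1 + x) a = 1 + a := by
    rw [cfc_const_add (1 : ℝ) (fun x => x) a, cfc_id' ℝ a, map_one]
  constructor
  · rw [← h1]
    exact (isUnit_cfc_iff _ a).2 hne
  · rw [← h1]
    exact cfc_inv _ a hne

theorem cfc_exF_of_posSemidef {k : ℕ} {a : Mat k} (ha : a.PosSemidef) :
    IsUnit (1 + a) ∧ cfc exF a = Ring.inverse (1 + a) := by
  refine cfc_exF_eq_inverse ha.1.isSelfAdjoint fun x hx => ?_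
  open scoped MatrixOrder in
  exact spectrum_nonneg_of_nonneg ha.nonneg hx

/-- With `X = A⁻¹`, `Y = B⁻¹` and `W` the inverse of the mean of `A` and `B`, expanding and using `W
(t A + (1 - t) B) W = W` writes the convexity defect of inversion as a combination of conjugates of
`A` and `B`. Both convexity and its equality case can be read off. -/
theorem sum_conj_eq_convexity_defect {R : Type*} [Ring R] [Algebra ℝ R] {A B X Y W : R} {t : ℝ}
    (hXA : X * A = 1) (hAX : A * X = 1) (hYB : Y * B = 1) (hBY : B * Y = 1)
    (hW : W * (t • A + (1 - t) • B) = 1) :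
    t • ((X - W) * A * (X - W)) + (1 - t) • ((Y - W) * B * (Y - W)) =
      t • X + (1 - t) • Y - W := by
  have hW' : t • (W * A * W) + (1 - t) • (W * B * W) = W := by
    have := congr(($hW) * W)
    simpa [mul_add, add_mul] using this
  have e1 : (X - W) * A * (X - W) = X - W - W + W * A * W := by
    rw [sub_mul, hXA, sub_mul, one_mul, mul_sub, mul_assoc W A X, hAX, mul_one]
    abel
  have e2 : (Y - W) * B * (Y - W) = Y - W - W + W * B * W := by
    rw [sub_mul, hYB, sub_mul, one_mul, mul_sub, mul_assoc W B Y, hBY, mul_one]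
    abel
  rw [e1, e2]
  calc t • (X - W - W + W * A * W) + (1 - t) • (Y - W - W + W * B * W)
      = t • X + (1 - t) • Y - W - W + (t • (W * A * W) + (1 - t) • (W * B * W)) := by module
    _ = _ := by rw [hW']; abel

theorem mul_eq_zero_of_trace_conj_eq_zero {k : ℕ} {P D : Mat k} (hP : P.PosSemidef)
    (h : (star D * P * D).trace = 0) : P * D = 0 := by
  open scoped MatrixOrder in
  obtain ⟨X, rfl⟩ := CStarAlgebra.nonneg_iff_eq_star_mul_self.1 hP.nonneg
  have h' : X * D = 0 := by
    rw [← Matrix.trace_conjTranspose_mul_self_eq_zero_iff, Matrix.conjTranspose_mul, ← h]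
    simp only [Matrix.star_eq_conjTranspose, mul_assoc]
  rw [mul_assoc, h', mul_zero]

theorem strictlyOperatorConvex_exF : StrictlyOperatorConvex exF := by
  have key (k : ℕ) (a b : Mat k) (ha : a.PosSemidef) (hb : b.PosSemidef) (t : ℝ) (h0 : 0 ≤ t)
      (h1 : t ≤ 1) :
      t • ((cfc exF a - cfc exF (t • a + (1 - t) • b)) * (1 + a) *
        (cfc exF a - cfc exF (t • a + (1 - t) • b))) +
      (1 - t) • ((cfc exF b - cfc exF (t • a + (1 - t) • b)) * (1 + b) *
        (cfc exF b - cfc exF (t • a + (1 - t) • b))) =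
      t • cfc exF a + (1 - t) • cfc exF b - cfc exF (t • a + (1 - t) • b) := by
    obtain ⟨ua, ea⟩ := cfc_exF_of_posSemidef ha
    obtain ⟨ub, eb⟩ := cfc_exF_of_posSemidef hb
    obtain ⟨uc, ec⟩ := cfc_exF_of_posSemidef ((ha.smul h0).add (hb.smul (sub_nonneg.2 h1)))
    refine sum_conj_eq_convexity_defect ?_ ?_ ?_ ?_ ?_
    · rw [ea, Ring.inverse_mul_cancel _ ua]
    · rw [ea, Ring.mul_inverse_cancel _ ua]
    · rw [eb, Ring.inverse_mul_cancel _ ub]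
    · rw [eb, Ring.mul_inverse_cancel _ ub]
    · rw [ec]
      convert Ring.inverse_mul_cancel _ uc using 2
      module
  have hstar (k : ℕ) (a b : Mat k) : star (cfc exF a - cfc exF b) = cfc exF a - cfc exF b :=
    (cfc_predicate exF a).sub (cfc_predicate exF b)
  have hpos (k : ℕ) (a b c : Mat k) (hc : c.PosSemidef) :
      ((cfc exF a - cfc exF b) * (1 + c) * (cfc exF a - cfc exF b)).PosSemidef := by
    have := (Matrix.PosSemidef.one.add hc).conjTranspose_mul_mul_same (cfc exF a - cfc exF b)
    rwa [← Matrix.star_eq_conjTranspose, hstar] at this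
  have hzero (k : ℕ) (a b c : Mat k) (hc : c.PosSemidef)
      (h : ((cfc exF a - cfc exF b) * (1 + c) * (cfc exF a - cfc exF b)).trace = 0) :
      cfc exF a = cfc exF b := by
    nth_rewrite 1 [← hstar k a b] at h
    have h' := mul_eq_zero_of_trace_conj_eq_zero (Matrix.PosSemidef.one.add hc) h
    exact sub_eq_zero.1 ((cfc_exF_of_posSemidef hc).1.mul_right_eq_zero.1 h')
  refine ⟨fun k a b ha hb t h0 h1 => ?_, fun k a b ha hb t h0 h1 h => ?_⟩
  · rw [← key k a b ha hb t h0 h1]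
    exact ((hpos _ _ _ _ ha).smul h0).add ((hpos _ _ _ _ hb).smul (sub_nonneg.2 h1))
  · have e := key k a b ha hb t h0.le h1.le
    rw [sub_eq_zero.2 h.symm] at e
    have e' := congrArg Matrix.trace e
    have p1 := (hpos k a (t • a + (1 - t) • b) a ha).trace_nonneg
    have p2 := (hpos k b (t • a + (1 - t) • b) b hb).trace_nonneg
    simp only [Matrix.trace_add, Matrix.trace_smul, Matrix.trace_zero] at e'
    have h1' := sub_pos.2 h1
    -- Two nonnegative traces with positive weights sum to zero, so each vanishes; then `exF a` and
    -- `exF b` both equal `exF` of the mean, and inverting gives `a = b`.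
    rw [add_eq_zero_iff_of_nonneg (smul_nonneg h0.le p1) (smul_nonneg h1'.le p2),
      smul_eq_zero_iff_right h0.ne', smul_eq_zero_iff_right h1'.ne'] at e'
    have hab := (hzero _ _ _ _ ha e'.1).trans (hzero _ _ _ _ hb e'.2).symm
    obtain ⟨ua, ea⟩ := cfc_exF_of_posSemidef ha
    obtain ⟨ub, eb⟩ := cfc_exF_of_posSemidef hb
    rw [ea, eb] at hab
    have hab' := congrArg Ring.inverse hab
    rw [Ring.inverse_inverse ua, Ring.inverse_inverse ub] at hab'
    exact add_left_cancel hab'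

variable {n m : ℕ}

/-! ### Powers of invertible positive elements -/

theorem isUnit_coe {A : Alg n} {a : A} (ha : IsUnit a) : IsUnit (a : Mat n) :=
  ha.map A.subtype

theorem star_pow_alg {A : Alg n} (a : A) (s : ℝ) : star (pow a s) = pow a s :=
  Subtype.ext (cfc_predicate (fun x : ℝ => x ^ s) (a : Mat n))

theorem spectrum_pos_of_isUnit {A : Alg n} {a : A} (ha : (a : Mat n).PosSemidef) (hu : IsUnit a) :
    ∀ x ∈ spectrum ℝ (a : Mat n), 0 < x := by
  intro x hx
  have h0 : 0 ≤ x := by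
    open scoped MatrixOrder in
    exact spectrum_nonneg_of_nonneg ha.nonneg hx
  refine h0.lt_of_ne ?_
  rintro rfl
  exact spectrum.zero_notMem ℝ (isUnit_coe hu) hx

theorem pow_mul_pow {A : Alg n} {a : A} (ha : (a : Mat n).PosSemidef) (hu : IsUnit a) (s t : ℝ) :
    pow a s * pow a t = pow a (s + t) := by
  have hpos := spectrum_pos_of_isUnit ha hu
  have hc (s : ℝ) : ContinuousOn (fun x : ℝ => x ^ s) (spectrum ℝ (a : Mat n)) := fun x hx =>
    (Real.continuousAt_rpow_const x s (Or.inl (hpos x hx).ne')).continuousWithinAt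
  refine Subtype.ext ?_
  change cfc (fun x : ℝ => x ^ s) (a : Mat n) * cfc (fun x : ℝ => x ^ t) (a : Mat n) =
    cfc (fun x : ℝ => x ^ (s + t)) (a : Mat n)
  rw [← cfc_mul _ _ _ (hc s) (hc t)]
  exact cfc_congr fun x hx => (Real.rpow_add (hpos x hx) s t).symm

theorem pow_one_eq {A : Alg n} {a : A} (ha : (a : Mat n).PosSemidef) : pow a 1 = a := by
  refine Subtype.ext ?_
  change cfc (fun x : ℝ => x ^ (1 : ℝ)) (a : Mat n) = a
  simp only [Real.rpow_one]
  exact cfc_id' ℝ (a : Mat n) ha.1.isSelfAdjoint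

theorem pow_zero_eq {A : Alg n} {a : A} (ha : (a : Mat n).PosSemidef) : pow a 0 = 1 := by
  refine Subtype.ext ?_
  change cfc (fun x : ℝ => x ^ (0 : ℝ)) (a : Mat n) = 1
  simp only [Real.rpow_zero]
  exact cfc_const_one ℝ (a : Mat n) ha.1.isSelfAdjoint

theorem mul_pow_neg_one {A : Alg n} {a : A} (ha : (a : Mat n).PosSemidef) (hu : IsUnit a) :
    a * pow a (-1) = 1 := by
  nth_rewrite 1 [← pow_one_eq ha]
  rw [pow_mul_pow ha hu, add_neg_cancel, pow_zero_eq ha]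

theorem pow_half_mul_pow_half {A : Alg n} {a : A} (ha : (a : Mat n).PosSemidef) (hu : IsUnit a) :
    pow a (1 / 2) * pow a (1 / 2) = a := by
  rw [pow_mul_pow ha hu, add_halves, pow_one_eq ha]

/-! ### The divergence of `(1 + x)⁻¹` -/

theorem relModular_toHS {A : Alg n} (σ ρ a : A) :
    relModular σ ρ (toHS a) = toHS (σ * a * pow ρ (-1)) := rfl

theorem leftAddRight_apply {A : Alg n} (σ ρ a : A) : leftAddRight σ ρ a = σ * a + a * ρ := rfl

theorem inner_toHS {A : Alg n} (a b : A) :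
    inner ℂ (toHS a) (toHS b) = ((star a * b : A) : Mat n).trace := rfl

theorem trace_coe_mul_comm {A : Alg n} (a b : A) :
    ((a * b : A) : Mat n).trace = ((b * a : A) : Mat n).trace :=
  Matrix.trace_mul_comm _ _

instance (A : Alg n) : FiniteDimensional ℂ A :=
  inferInstanceAs (FiniteDimensional ℂ (Subalgebra.toSubmodule A.toSubalgebra))

/-- With `k = ρ^{-1/2}`, cyclicity of the trace gives `⟨Δ a, a⟩ = Tr (a k)* σ (a k)`. -/
theorem isPositive_relModular {A : Alg n} {σ ρ : A} (hσ : (σ : Mat n).PosSemidef)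
    (hρ : (ρ : Mat n).PosSemidef) (hu : IsUnit ρ) : (relModular σ ρ).IsPositive := by
  rw [ContinuousLinearMap.isPositive_iff_complex]
  intro x
  obtain ⟨a, rfl⟩ := toHS.surjective x
  have h : 0 ≤ inner ℂ (relModular σ ρ (toHS a)) (toHS a) := by
    have hk : pow ρ (-1) = pow ρ (-(1 / 2)) * pow ρ (-(1 / 2)) := by
      rw [pow_mul_pow hρ hu]
      norm_num
    set k := pow ρ (-(1 / 2)) with hkdef
    have hks : star k = k := star_pow_alg _ _
    have hσs : star σ = σ := Subtype.ext hσ.1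
    rw [relModular_toHS, inner_toHS, hk]
    have e : ((star (σ * a * (k * k)) * a : A) : Mat n).trace =
        ((star (a * k) * σ * (a * k) : A) : Mat n).trace := by
      have e1 : star (σ * a * (k * k)) * a = k * (k * star a * σ * a) := by
        simp only [star_mul, hks, hσs, mul_assoc]
      have e2 : star (a * k) * σ * (a * k) = k * star a * σ * a * k := by
        simp only [star_mul, hks, mul_assoc]
      rw [e1, e2, trace_coe_mul_comm]
    rw [e]
    exact (hσ.conjTranspose_mul_mul_same ((a * k : A) : Mat n)).trace_nonneg
  have h' := Complex.nonneg_iff.1 h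
  exact ⟨Complex.ext rfl h'.2, h'.1⟩

theorem isUnit_one_add_relModular {A : Alg n} {σ ρ : A} (hσ : (σ : Mat n).PosSemidef)
    (hρ : (ρ : Mat n).PosSemidef) (hu : IsUnit ρ) :
    IsUnit (1 + relModular σ ρ) ∧
      cfc exF (relModular σ ρ) = Ring.inverse (1 + relModular σ ρ) := by
  have hp := isPositive_relModular hσ hρ hu
  refine cfc_exF_eq_inverse hp.isSelfAdjoint fun x hx => ?_
  exact spectrum_nonneg_of_nonneg ((ContinuousLinearMap.nonneg_iff_isPositive _).2 hp) hx

theorem one_add_relModular_toHS {A : Alg n} {σ ρ : A} (hρ : (ρ : Mat n).PosSemidef)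
    (hu : IsUnit ρ) (a : A) :
    (1 + relModular σ ρ) (toHS a) = toHS (leftAddRight σ ρ a * pow ρ (-1)) := by
  rw [leftAddRight_apply, add_mul, mul_assoc a, mul_pow_neg_one hρ hu, mul_one, add_comm, map_add]
  rfl

theorem isUnit_leftAddRight {A : Alg n} {σ ρ : A} (hσ : (σ : Mat n).PosSemidef)
    (hρ : (ρ : Mat n).PosSemidef) (hu : IsUnit ρ) : IsUnit (leftAddRight σ ρ) := by
  rw [LinearMap.isUnit_iff_ker_eq_bot, LinearMap.ker_eq_bot']
  intro a ha
  have h := one_add_relModular_toHS (σ := σ) hρ hu a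
  rw [ha, zero_mul, map_zero] at h
  have h' := (isUnit_one_add_relModular hσ hρ hu).1
  have h'' := congr(Ring.inverse (1 + relModular σ ρ) $h)
  rw [← mul_apply_eq_comp, Ring.inverse_mul_cancel _ h', map_zero] at h''
  exact toHS.map_eq_zero_iff.1 h''

theorem inverse_leftAddRight_eq {A : Alg n} {σ ρ x y : A} (h : IsUnit (leftAddRight σ ρ))
    (hx : leftAddRight σ ρ x = y) : Ring.inverse (leftAddRight σ ρ) y = x := by
  rw [← hx, ← Module.End.mul_apply, Ring.inverse_mul_cancel _ h, Module.End.one_apply]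

theorem leftAddRight_inverse {A : Alg n} {σ ρ : A} (h : IsUnit (leftAddRight σ ρ)) (y : A) :
    leftAddRight σ ρ (Ring.inverse (leftAddRight σ ρ) y) = y := by
  rw [← Module.End.mul_apply, Ring.mul_inverse_cancel _ h, Module.End.one_apply]

/-- If `σ y + y ρ = ρ`, then `1 + Δ` maps `y ρ^{1/2}` to `ρ^{1/2}`, so `f(Δ) ρ^{1/2} = y ρ^{1/2}`,
and pairing with `ρ^{1/2}` gives `Tr ρ y`. -/
theorem fDivergence_exF {A : Alg n} {σ ρ : A} (hσ : (σ : Mat n).PosSemidef)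
    (hρ : (ρ : Mat n).PosSemidef) (hu : IsUnit ρ) :
    (fDivergence exF σ ρ : ℂ) =
      ((ρ * Ring.inverse (leftAddRight σ ρ) ρ : A) : Mat n).trace := by
  obtain ⟨h1, h2⟩ := isUnit_one_add_relModular hσ hρ hu
  set y := Ring.inverse (leftAddRight σ ρ) ρ with hy
  have hLy : σ * y + y * ρ = ρ := leftAddRight_inverse (isUnit_leftAddRight hσ hρ hu) ρ
  set r := pow ρ (1 / 2) with hr
  have hrr : r * r = ρ := pow_half_mul_pow_half hρ hu
  have hcomm : ρ * r = r * ρ := by rw [← hrr, mul_assoc]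
  have hval : cfc exF (relModular σ ρ) (toHS r) = toHS (y * r) := by
    have e : (1 + relModular σ ρ) (toHS (y * r)) = toHS r := by
      rw [one_add_relModular_toHS hρ hu, leftAddRight_apply, mul_assoc y r ρ, ← hcomm, ← mul_assoc,
        ← mul_assoc, ← add_mul, hLy, hcomm, mul_assoc, mul_pow_neg_one hρ hu, mul_one]
    rw [h2, ← e, ← mul_apply_eq_comp, Ring.inverse_mul_cancel _ h1,
      one_apply_eq_self]
  have hsa : IsSelfAdjoint (cfc exF (relModular σ ρ)) := cfc_predicate _ _
  -- The divergence is defined as a real part; self-adjointness of `f(Δ)` shows that the inner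
  -- product is already real.
  have hre := hsa.isSymmetric.coe_re_inner_self_apply (toHS r)
  rw [fDivergence]
  refine hre.trans ?_
  change inner ℂ (toHS r) (cfc exF (relModular σ ρ) (toHS r)) = _
  rw [hval, inner_toHS, star_pow_alg, ← hr, ← mul_assoc, trace_coe_mul_comm, ← mul_assoc, hrr]

/-! ### The trace on an algebra -/

/-- The matrix trace as a functional on `A`. -/
def algTrace (A : Alg n) : A →ₗ[ℂ] ℂ :=
  Matrix.traceLinearMap (Fin n) ℂ ℂ ∘ₗ A.subtype.toAlgHom.toLinearMap

theorem algTrace_apply {A : Alg n} (a : A) : algTrace A a = (a : Mat n).trace := rfl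

theorem algTrace_mul_comm {A : Alg n} (a b : A) : algTrace A (a * b) = algTrace A (b * a) :=
  trace_coe_mul_comm a b

theorem algTrace_star {A : Alg n} (a : A) : algTrace A (star a) = star (algTrace A a) :=
  Matrix.trace_conjTranspose (a : Mat n)

theorem eq_zero_of_algTrace_star_mul_self {A : Alg n} {a : A} (h : algTrace A (star a * a) = 0) :
    a = 0 :=
  Subtype.ext (Matrix.trace_conjTranspose_mul_self_eq_zero_iff.1 h)

theorem eq_of_algTrace_mul_eq {A : Alg n} {a b : A}
    (h : ∀ c, algTrace A (a * c) = algTrace A (b * c)) : a = b := by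
  rw [← sub_eq_zero]
  apply eq_zero_of_algTrace_star_mul_self
  rw [algTrace_mul_comm, sub_mul, map_sub, h, sub_self]

theorem coe_posSemidef_star_mul_self {A : Alg n} (a : A) : ((star a * a : A) : Mat n).PosSemidef :=
  Matrix.posSemidef_conjTranspose_mul_self _

theorem PosSemidef.coe_conj {A : Alg n} {a : A} (ha : (a : Mat n).PosSemidef) (c : A) :
    ((star c * a * c : A) : Mat n).PosSemidef :=
  ha.conjTranspose_mul_mul_same _

theorem algTrace_mul_nonneg {A : Alg n} {a b : A} (ha : (a : Mat n).PosSemidef)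
    (hb : (b : Mat n).PosSemidef) : 0 ≤ algTrace A (a * b) := by
  open scoped MatrixOrder in
  obtain ⟨X, hX⟩ := CStarAlgebra.nonneg_iff_eq_star_mul_self.1 ha.nonneg
  change 0 ≤ ((a : Mat n) * b).trace
  rw [hX, mul_assoc, Matrix.trace_mul_comm]
  exact (hb.mul_mul_conjTranspose_same X).trace_nonneg

/-! ### Combinations of a projection and its complement -/

/-- `α p + β (1 - p)`. -/
def projComb {R : Type*} [Ring R] [Algebra ℂ R] (p : R) (α β : ℂ) : R := α • p + β • (1 - p)

section projComb

variable {R : Type*} [Ring R] [Algebra ℂ R] {p : R}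

theorem projComb_mul (hp : p * p = p) (α β γ δ : ℂ) :
    projComb p α β * projComb p γ δ = projComb p (α * γ) (β * δ) := by
  have h1 : p * (1 - p) = 0 := by rw [mul_sub, hp, mul_one, sub_self]
  have h2 : (1 - p) * p = 0 := by rw [sub_mul, hp, one_mul, sub_self]
  have h3 : (1 - p) * (1 - p) = 1 - p := by rw [mul_sub, h2, mul_one, sub_zero]
  simp [projComb, mul_add, add_mul, hp, h1, h2, h3, smul_smul, mul_comm]

theorem projComb_add (α β γ δ : ℂ) :
    projComb p α β + projComb p γ δ = projComb p (α + γ) (β + δ) := by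
  simp only [projComb]
  module

theorem projComb_sub (α β γ δ : ℂ) :
    projComb p α β - projComb p γ δ = projComb p (α - γ) (β - δ) := by
  simp only [projComb]
  module

theorem smul_projComb (c α β : ℂ) : c • projComb p α β = projComb p (c * α) (c * β) := by
  simp only [projComb]
  module

theorem projComb_const (α : ℂ) : projComb p α α = α • 1 := by
  simp only [projComb]
  module

theorem projComb_one_one : projComb p 1 1 = 1 := by rw [projComb_const, one_smul]

theorem projComb_one_zero : projComb p 1 0 = p := by simp [projComb]

theorem projComb_zero_one : projComb p 0 1 = 1 - p := by simp [projComb]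

theorem star_projComb [StarRing R] [StarModule ℂ R] (hp : star p = p) (α β : ℂ) :
    star (projComb p α β) = projComb p (star α) (star β) := by
  simp [projComb, hp]

theorem projComb_mul_inv (hp : p * p = p) {α β : ℂ} (hα : α ≠ 0) (hβ : β ≠ 0) :
    projComb p α β * projComb p α⁻¹ β⁻¹ = 1 := by
  rw [projComb_mul hp, mul_inv_cancel₀ hα, mul_inv_cancel₀ hβ, projComb_one_one]

theorem projComb_inv_mul (hp : p * p = p) {α β : ℂ} (hα : α ≠ 0) (hβ : β ≠ 0) :
    projComb p α⁻¹ β⁻¹ * projComb p α β = 1 := by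
  rw [projComb_mul hp, inv_mul_cancel₀ hα, inv_mul_cancel₀ hβ, projComb_one_one]

theorem isUnit_projComb (hp : p * p = p) {α β : ℂ} (hα : α ≠ 0) (hβ : β ≠ 0) :
    IsUnit (projComb p α β) :=
  ⟨⟨_, _, projComb_mul_inv hp hα hβ, projComb_inv_mul hp hα hβ⟩, rfl⟩

theorem inverse_projComb (hp : p * p = p) {α β : ℂ} (hα : α ≠ 0) (hβ : β ≠ 0) :
    Ring.inverse (projComb p α β) = projComb p α⁻¹ β⁻¹ := by
  rw [← mul_one (Ring.inverse _), ← projComb_mul_inv hp hα hβ,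
    Ring.inverse_mul_cancel_left _ _ (isUnit_projComb hp hα hβ)]

end projComb

theorem exX_eq {A : Alg n} (p : A) (l : ℝ) : exX p l = projComb p (1 - l) l := rfl

theorem one_sub_exX {A : Alg n} (p : A) (l : ℝ) : 1 - exX p l = projComb p l (1 - l) := by
  rw [exX_eq, ← projComb_one_one (p := p), projComb_sub, sub_sub_cancel]

theorem inverse_one_sub_exX {A : Alg n} {p : A} (hp : p * p = p) {l : ℝ} (h0 : l ≠ 0)
    (h1 : l ≠ 1) :
    Ring.inverse (1 - exX p l) = (((l * (1 - l))⁻¹ : ℝ) : ℂ) • exX p l := by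
  have h0' : (l : ℂ) ≠ 0 := by exact_mod_cast h0
  have h1' : (1 - l : ℂ) ≠ 0 := by
    rw [sub_ne_zero]
    exact_mod_cast h1.symm
  rw [one_sub_exX, inverse_projComb hp h0' h1', exX_eq, smul_projComb]
  congr 1 <;> push_cast <;> field_simp

theorem posSemidef_projComb {A : Alg n} {p : A} (hp : IsStarProjection p) {α β : ℂ} (hα : 0 ≤ α)
    (hβ : 0 ≤ β) : ((projComb p α β : A) : Mat n).PosSemidef := by
  have h (r : A) (hr : IsStarProjection r) : (r : Mat n).PosSemidef := by
    have := coe_posSemidef_star_mul_self r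
    rwa [hr.isSelfAdjoint.star_eq, hr.isIdempotentElem.eq] at this
  exact ((h p hp).smul hα).add ((h _ hp.one_sub).smul hβ)

theorem isStarProjection_gen {A : Alg n} {p : A} (hp : IsStarProjection p) :
    IsStarProjection (genBy.gen p) :=
  ⟨Subtype.ext (congrArg (Subtype.val : A → Mat n) hp.isIdempotentElem.eq),
    Subtype.ext (congrArg (Subtype.val : A → Mat n) hp.isSelfAdjoint.star_eq)⟩

theorem exists_eq_projComb {A : Alg n} {p : A} (hp : IsStarProjection p) (b : genBy p) :
    ∃ α β : ℂ, b = projComb (genBy.gen p) α β := by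
  have hg := (isStarProjection_gen hp).isIdempotentElem.eq
  have hs := (isStarProjection_gen hp).isSelfAdjoint.star_eq
  refine StarAlgebra.adjoin_induction_subtype
    (p := fun b : genBy p => ∃ α β : ℂ, b = projComb (genBy.gen p) α β) b ?_ ?_ ?_ ?_ ?_
  · rintro x hx
    obtain rfl := Set.mem_singleton_iff.1 hx
    exact ⟨1, 0, projComb_one_zero.symm⟩
  · exact fun r => ⟨r, r, by rw [projComb_const, Algebra.algebraMap_eq_smul_one]; rfl⟩
  · rintro _ _ ⟨α, β, rfl⟩ ⟨γ, δ, rfl⟩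
    exact ⟨_, _, projComb_add ..⟩
  · rintro _ _ ⟨α, β, rfl⟩ ⟨γ, δ, rfl⟩
    exact ⟨_, _, projComb_mul hg ..⟩
  · rintro _ ⟨α, β, rfl⟩
    exact ⟨_, _, star_projComb hs ..⟩

theorem genBy_mul_comm {A : Alg n} {p : A} (hp : IsStarProjection p) (b c : genBy p) :
    b * c = c * b := by
  obtain ⟨α, β, rfl⟩ := exists_eq_projComb hp b
  obtain ⟨γ, δ, rfl⟩ := exists_eq_projComb hp c
  have h := (isStarProjection_gen hp).isIdempotentElem.eq
  rw [projComb_mul h, projComb_mul h, mul_comm α, mul_comm β]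

theorem inclusion_projComb {A : Alg n} (p : A) (α β : ℂ) :
    StarSubalgebra.inclusion (genBy_le p) (projComb (genBy.gen p) α β) = projComb p α β := rfl

/-! ### Trace preserving conditional expectations -/

namespace IsTracePreservingCondExp

variable {A B : Alg n} {h : B ≤ A} {T : A →ₗ[ℂ] B} (hT : IsTracePreservingCondExp h T)
include hT

/-- Since the trace form is nondegenerate, this pairing determines `T`; uniqueness, compatibility
with `star` and the form of the adjoint all follow from it. -/
theorem algTrace_mul (a : A) (b : B) :
    algTrace B (T a * b) = algTrace A (a * StarSubalgebra.inclusion h b) := by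
  have e := hT.bimodule a 1 b
  rw [map_one, one_mul, one_mul] at e
  rw [← e]
  exact hT.trace_eq _

theorem map_star_eq (a : A) : T (star a) = star (T a) := by
  refine eq_of_algTrace_mul_eq fun b => ?_
  rw [hT.algTrace_mul, ← star_star (star (T a) * b), algTrace_star, star_mul, star_star,
    algTrace_mul_comm (star b), hT.algTrace_mul, ← algTrace_star,
    star_mul, map_star, star_star, algTrace_mul_comm]

theorem hsAdjoint_eq (b : B) : hsAdjoint T b = StarSubalgebra.inclusion h b := by
  refine eq_of_algTrace_mul_eq fun a => ?_
  rw [algTrace_mul_comm, algTrace_mul_comm _ a, ← hT.algTrace_mul]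
  have := hsAdjoint_spec T (star a) b
  rw [← StarMemClass.coe_star, hT.map_star_eq, star_star] at this
  rw [algTrace_apply, algTrace_apply]
  simpa using this.symm

/-- The adjoint is the inclusion, a unital `*`-homomorphism, so the Schwarz inequality is an
equality. -/
theorem isUnitalSchwarz_hsAdjoint : IsUnitalSchwarz (hsAdjoint T) where
  unital := by rw [hT.hsAdjoint_eq, map_one]
  schwarz a := by
    simp only [hT.hsAdjoint_eq, map_mul, map_star, sub_self]
    exact Matrix.PosSemidef.zero

theorem unique {T' : A →ₗ[ℂ] B} (hT' : IsTracePreservingCondExp h T') : T' = T :=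
  LinearMap.ext fun a => eq_of_algTrace_mul_eq fun b => by rw [hT.algTrace_mul, hT'.algTrace_mul]

end IsTracePreservingCondExp

theorem algTrace_projection_ne_zero {A : Alg n} {p : A} (hp : IsStarProjection p) (h : p ≠ 0) :
    algTrace A p ≠ 0 := fun h0 => h <| eq_zero_of_algTrace_star_mul_self <| by
  rwa [hp.isSelfAdjoint.star_eq, hp.isIdempotentElem.eq]

/-- The trace preserving conditional expectation onto the algebra generated by a projection. -/
noncomputable def projCondExp {A : Alg n} (p : A) : A →ₗ[ℂ] genBy p :=
  ((algTrace A p)⁻¹ • algTrace A ∘ₗ LinearMap.mulLeft ℂ p).smulRight (genBy.gen p) +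
    ((algTrace A (1 - p))⁻¹ • algTrace A ∘ₗ LinearMap.mulLeft ℂ (1 - p)).smulRight
      (1 - genBy.gen p)

theorem projCondExp_apply {A : Alg n} (p a : A) :
    projCondExp p a = projComb (genBy.gen p) ((algTrace A p)⁻¹ * algTrace A (p * a))
      ((algTrace A (1 - p))⁻¹ * algTrace A ((1 - p) * a)) := rfl

theorem algTrace_projComb {A : Alg n} (p : A) (α β : ℂ) :
    algTrace A (projComb p α β) = α * algTrace A p + β * algTrace A (1 - p) := by
  simp [projComb]

theorem isTracePreservingCondExp_projCondExp {A : Alg n} {p : A} (hp : IsStarProjection p)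
    (h0 : p ≠ 0) (h1 : p ≠ 1) : IsTracePreservingCondExp (genBy_le p) (projCondExp p) := by
  have t0 := algTrace_projection_ne_zero hp h0
  have t1 := algTrace_projection_ne_zero hp.one_sub (sub_ne_zero.2 h1.symm)
  have psd (r : A) (hr : IsStarProjection r) : (r : Mat n).PosSemidef := by
    rw [← projComb_one_zero (p := r)]
    exact posSemidef_projComb hr zero_le_one le_rfl
  have hi := hp.isIdempotentElem.eq
  have hmul (r a b c : A) : algTrace A (r * (b * a * c)) = algTrace A (c * r * b * a) := by
    rw [← mul_assoc, algTrace_mul_comm]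
    simp only [mul_assoc]
  refine ⟨fun a ha => ?_, fun a b c => ?_, fun a => ?_⟩
  · have key (r : A) (hr : IsStarProjection r) : 0 ≤ (algTrace A r)⁻¹ * algTrace A (r * a) :=
      mul_nonneg (inv_nonneg.2 (psd r hr).trace_nonneg) (algTrace_mul_nonneg (psd r hr) ha)
    exact posSemidef_projComb (isStarProjection_gen hp) (key p hp) (key _ hp.one_sub)
  · obtain ⟨α, β, rfl⟩ := exists_eq_projComb hp b
    obtain ⟨γ, δ, rfl⟩ := exists_eq_projComb hp c
    have hg := (isStarProjection_gen hp).isIdempotentElem.eq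
    rw [inclusion_projComb, inclusion_projComb, projCondExp_apply, projCondExp_apply,
      projComb_mul hg, projComb_mul hg, hmul, hmul]
    have e1 : projComb p γ δ * p * projComb p α β = (γ * α) • p := by
      nth_rewrite 2 [← projComb_one_zero (p := p)]
      rw [projComb_mul hi, projComb_mul hi]
      simp [projComb]
    have e2 : projComb p γ δ * (1 - p) * projComb p α β = (δ * β) • (1 - p) := by
      rw [← projComb_zero_one (p := p), projComb_mul hi, projComb_mul hi]
      simp [projComb]
    rw [e1, e2, smul_mul_assoc, smul_mul_assoc, map_smul, map_smul, smul_eq_mul, smul_eq_mul]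
    congr 1 <;> ring
  · rw [← algTrace_apply, ← algTrace_apply, projCondExp_apply, algTrace_projComb]
    change _ * algTrace A p + _ * algTrace A (1 - p) = _
    rw [inv_mul_eq_div, div_mul_cancel₀ _ t0, inv_mul_eq_div, div_mul_cancel₀ _ t1, ← map_add,
      ← add_mul, add_sub_cancel, one_mul]

theorem existsUnique_condExp {A : Alg n} {p : A} (hp : IsStarProjection p) (h0 : p ≠ 0)
    (h1 : p ≠ 1) : ∃! T : A →ₗ[ℂ] genBy p, IsTracePreservingCondExp (genBy_le p) T :=
  ⟨projCondExp p, isTracePreservingCondExp_projCondExp hp h0 h1, fun _ h =>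
    (isTracePreservingCondExp_projCondExp hp h0 h1).unique h⟩

/-! ### Schwarz maps into the algebra of a projection -/

/-- A unital positive map into an abelian algebra is Schwarz: each coordinate is a state, and the
inequality is `|φ(a)|² ≤ φ(a* a)`. -/
theorem isUnitalSchwarz_of_pos {A : Alg m} {B : Alg n} {p : B} (hp : IsStarProjection p)
    {D : A →ₗ[ℂ] genBy p} (h1 : D 1 = 1) (hstar : ∀ a, D (star a) = star (D a))
    (hpos : ∀ a : A, (D (star a * a) : Mat n).PosSemidef) : IsUnitalSchwarz D where
  unital := h1
  schwarz a := by
    have hg := isStarProjection_gen hp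
    have hi := hg.isIdempotentElem.eq
    obtain ⟨α, β, hα⟩ := exists_eq_projComb hp (D a)
    obtain ⟨γ, δ, hγ⟩ := exists_eq_projComb hp (D (star a * a))
    have key (c : ℂ) : D (star (a - c • 1) * (a - c • 1)) = projComb (genBy.gen p)
        (γ - star c * α - c * star α + star c * c) (δ - star c * β - c * star β + star c * c) := by
      have e : star (a - c • 1) * (a - c • 1) =
          star a * a - star c • a - c • star a + (star c * c) • 1 := by
        simp only [star_sub, star_smul, star_one, sub_mul, mul_sub, smul_mul_assoc, mul_smul_comm,
          one_mul, mul_one, smul_smul, smul_sub]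
        module
      rw [e, map_add, map_sub, map_sub, map_smul, map_smul, map_smul, h1, hstar, hα, hγ,
        star_projComb hg.isSelfAdjoint.star_eq, ← projComb_one_one (p := genBy.gen p)]
      simp only [smul_projComb, projComb_sub, projComb_add, mul_one]
    -- Shifting by the coordinate `α` of `D a` makes the `p`-coordinate equal to `γ - |α|²`;
    -- shifting by `β` does the same for `1 - p`. Compressing to each corner and adding gives the
    -- defect.
    have k1 := hpos (a - α • 1)
    have k2 := hpos (a - β • 1)
    rw [key] at k1 k2
    have l1 := PosSemidef.coe_conj k1 (genBy.gen p)
    have l2 := PosSemidef.coe_conj k2 (1 - genBy.gen p)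
    rw [hg.isSelfAdjoint.star_eq] at l1
    nth_rewrite 1 3 [← projComb_one_zero (p := genBy.gen p)] at l1
    rw [projComb_mul hi, projComb_mul hi] at l1
    rw [hg.one_sub.isSelfAdjoint.star_eq, ← projComb_zero_one, projComb_mul hi,
      projComb_mul hi] at l2
    have l := l1.add l2
    have e : D (star a * a) - star (D a) * D a =
        projComb (genBy.gen p) (1 * (γ - star α * α - α * star α + star α * α) * 1)
          (0 * (δ - star α * β - α * star β + star α * α) * 0) +
        projComb (genBy.gen p) (0 * (γ - star β * α - β * star α + star β * β) * 0)
          (1 * (δ - star β * β - β * star β + star β * β) * 1) := by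
      rw [hα, hγ, star_projComb hg.isSelfAdjoint.star_eq, projComb_mul hi, projComb_sub,
        projComb_add]
      congr 1 <;> ring
    rw [e]
    exact l

/-! ### The construction -/

theorem algTrace_projection_mul_pos {A : Alg n} {σ p : A} (hσ : (σ : Mat n).PosSemidef)
    (hu : IsUnit σ) (hp : IsStarProjection p) (h : p ≠ 0) : 0 < algTrace A (p * σ) := by
  have e : algTrace A (p * σ) = algTrace A (star p * σ * p) := by
    rw [hp.isSelfAdjoint.star_eq, algTrace_mul_comm (p * σ), ← mul_assoc,
      hp.isIdempotentElem.eq]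
  rw [e]
  refine lt_of_le_of_ne (PosSemidef.coe_conj hσ p).trace_nonneg fun h0 => h ?_
  exact hu.mul_right_eq_zero.1 (Subtype.ext (mul_eq_zero_of_trace_conj_eq_zero hσ h0.symm))

theorem ne_zero_of_not_commute {A : Alg n} {σ p : A} (h : σ * p ≠ p * σ) : p ≠ 0 := by
  rintro rfl
  simp at h

theorem ne_one_of_not_commute {A : Alg n} {σ p : A} (h : σ * p ≠ p * σ) : p ≠ 1 := by
  rintro rfl
  simp at h

theorem trace_projection_mem_Ioo {A : Alg n} {σ p : A} {l : ℝ} (hσ : IsDensity σ) (hu : IsUnit σ)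
    (hp : IsStarProjection p) (h : σ * p ≠ p * σ) (hl : algTrace A (p * σ) = l) :
    0 < l ∧ l < 1 := by
  have h0 := algTrace_projection_mul_pos hσ.pos hu hp (ne_zero_of_not_commute h)
  have h1 := algTrace_projection_mul_pos hσ.pos hu hp.one_sub
    (sub_ne_zero.2 (ne_one_of_not_commute h).symm)
  rw [sub_mul, one_mul, map_sub, hl, algTrace_apply, hσ.trace_eq] at h1
  rw [hl] at h0
  exact ⟨by exact_mod_cast h0, sub_pos.1 (by exact_mod_cast h1)⟩

section construction

variable {A : Alg n} {σ p : A} {l : ℝ}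

theorem star_exX (hp : IsStarProjection p) : star (exX p l) = exX p l := by
  rw [exX_eq, star_projComb hp.isSelfAdjoint.star_eq]
  simp

theorem isUnit_exX (hp : p * p = p) (h0 : l ≠ 0) (h1 : l ≠ 1) : IsUnit (exX p l) :=
  isUnit_projComb hp (sub_ne_zero.2 (by exact_mod_cast h1.symm)) (by exact_mod_cast h0)

theorem isUnit_one_sub_exX (hp : p * p = p) (h0 : l ≠ 0) (h1 : l ≠ 1) : IsUnit (1 - exX p l) := by
  rw [one_sub_exX]
  exact isUnit_projComb hp (by exact_mod_cast h0) (sub_ne_zero.2 (by exact_mod_cast h1.symm))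

theorem exRho_eq (hp : p * p = p) (h0 : l ≠ 0) (h1 : l ≠ 1) :
    exRho σ p l = (((l * (1 - l))⁻¹ : ℝ) : ℂ) • (exX p l * σ * exX p l) := by
  rw [exRho, inverse_one_sub_exX hp h0 h1, smul_mul_assoc, smul_mul_assoc]

/-- Since `x (1 - x)⁻¹ = (1 - x)⁻¹ - 1`, the term `x ρ` is `ρ - σ x`. -/
theorem leftAddRight_exX (h : IsUnit (1 - exX p l)) :
    leftAddRight σ (exRho σ p l) (exX p l) = exRho σ p l := by
  have e : exX p l * Ring.inverse (1 - exX p l) = Ring.inverse (1 - exX p l) - 1 := by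
    have := Ring.mul_inverse_cancel _ h
    rwa [sub_mul, one_mul, sub_eq_iff_eq_add', ← sub_eq_iff_eq_add, eq_comm] at this
  rw [leftAddRight_apply, exRho, ← mul_assoc, ← mul_assoc, e, sub_mul, sub_mul, one_mul,
    add_sub_cancel]

theorem isDensity_exRho (hσ : IsDensity σ) (hp : IsStarProjection p)
    (hl : algTrace A (p * σ) = l) (h0 : 0 < l) (h1 : l < 1) : IsDensity (exRho σ p l) := by
  have hi := hp.isIdempotentElem.eq
  have hc : (0 : ℝ) ≤ (l * (1 - l))⁻¹ := inv_nonneg.2 (mul_nonneg h0.le (sub_nonneg.2 h1.le))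
  rw [exRho_eq hi h0.ne' h1.ne]
  constructor
  · have h := PosSemidef.coe_conj hσ.pos (exX p l)
    rw [star_exX hp] at h
    exact h.smul (by exact_mod_cast hc)
  -- By cyclicity this is `Tr x² σ = (1 - l)² l + l² (1 - l)`, where `l = Tr p σ` enters.
  · have e : algTrace A (exX p l * σ * exX p l) = l * (1 - l) := by
      have hs : algTrace A σ = 1 := hσ.trace_eq
      rw [algTrace_mul_comm, ← mul_assoc, exX_eq, projComb_mul hi, projComb]
      simp only [add_mul, smul_mul_assoc, sub_mul, one_mul, map_add, map_smul, map_sub, hl, hs,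
        smul_eq_mul]
      ring
    rw [← algTrace_apply, map_smul, e, smul_eq_mul]
    have h0' : (l : ℂ) ≠ 0 := by exact_mod_cast h0.ne'
    have h1' : (1 - l : ℂ) ≠ 0 := sub_ne_zero.2 (by exact_mod_cast h1.ne')
    push_cast
    field_simp

end construction

namespace IsTracePreservingCondExp

variable {A : Alg n} {σ p : A} {l : ℝ} {T : A →ₗ[ℂ] genBy p}
  (hT : IsTracePreservingCondExp (genBy_le p) T)
include hT

theorem map_one : T 1 = 1 :=
  eq_of_algTrace_mul_eq fun b => by rw [hT.algTrace_mul, one_mul, one_mul]; rfl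

theorem map_isDensity (hσ : IsDensity σ) : IsDensity (T σ) :=
  ⟨hT.pos σ hσ.pos, (hT.trace_eq σ).trans hσ.trace_eq⟩

/-- If a coordinate of `T σ` vanished, the trace of `σ` against `p` or `1 - p` would be zero,
contradicting invertibility of `σ`. -/
theorem isUnit_map (hσ : (σ : Mat n).PosSemidef) (hu : IsUnit σ) (hp : IsStarProjection p)
    (h0 : p ≠ 0) (h1 : p ≠ 1) : IsUnit (T σ) := by
  have hg := isStarProjection_gen hp
  obtain ⟨α, β, h⟩ := exists_eq_projComb hp (T σ)
  have key (r : genBy p) (hr : StarSubalgebra.inclusion (genBy_le p) r ≠ 0)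
      (hr' : IsStarProjection (StarSubalgebra.inclusion (genBy_le p) r)) : r * T σ ≠ 0 := by
    intro h
    have := algTrace_projection_mul_pos hσ hu hr' hr
    rw [algTrace_mul_comm, ← hT.algTrace_mul, genBy_mul_comm hp, h, map_zero] at this
    exact this.false
  have k0 := key (genBy.gen p) h0 hp
  have k1 := key (1 - genBy.gen p) (sub_ne_zero.2 h1.symm) hp.one_sub
  rw [h] at k0 k1 ⊢
  refine isUnit_projComb hg.isIdempotentElem.eq ?_ ?_
  · rintro rfl
    apply k0
    nth_rewrite 1 [← projComb_one_zero (p := genBy.gen p)]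
    rw [projComb_mul hg.isIdempotentElem.eq]
    simp [projComb]
  · rintro rfl
    apply k1
    rw [← projComb_zero_one, projComb_mul hg.isIdempotentElem.eq]
    simp [projComb]

theorem isUnitalSchwarz_dualMap (hσ : (σ : Mat n).PosSemidef) (hu : IsUnit σ)
    (hp : IsStarProjection p) (hTu : IsUnit (T σ)) : IsUnitalSchwarz (dualMap T σ) := by
  have hTσ := hT.pos σ hσ
  set k := pow (T σ) (-(1 / 2)) with hk
  set r := pow σ (1 / 2) with hr
  have hks : star k = k := star_pow_alg _ _
  have hrs : star r = r := star_pow_alg _ _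
  have happ (a : A) : dualMap T σ a = k * T (r * a * r) * k := rfl
  refine isUnitalSchwarz_of_pos hp ?_ (fun a => ?_) fun a => ?_
  · rw [happ, mul_one, hr, pow_half_mul_pow_half hσ hu, genBy_mul_comm hp k, mul_assoc, hk,
      pow_mul_pow hTσ hTu, ← neg_add, add_halves, mul_pow_neg_one hTσ hTu]
  · rw [happ, happ, star_mul, star_mul, hks, ← hT.map_star_eq, star_mul, star_mul, hrs]
    simp only [mul_assoc]
  · rw [happ]
    have h1 : ((r * (star a * a) * r : A) : Mat n).PosSemidef := by
      have := PosSemidef.coe_conj (coe_posSemidef_star_mul_self a) r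
      rwa [hrs] at this
    have h2 := PosSemidef.coe_conj (hT.pos _ h1) k
    rwa [hks] at h2

theorem map_exRho (hp : IsStarProjection p) (h0 : l ≠ 0) (h1 : l ≠ 1) :
    T (exRho σ p l) = exRho (T σ) (genBy.gen p) l := by
  rw [exRho_eq hp.isIdempotentElem.eq h0 h1,
    exRho_eq (isStarProjection_gen hp).isIdempotentElem.eq h0 h1, map_smul, ← hT.bimodule]
  rfl

end IsTracePreservingCondExp

/-! ### Failure of reversibility -/

/-- A Schwarz map is positive on elements `a* a`, and positivity passes to `S` by duality: the trace
is that of `b` against `S*(c c*)`. The `star` on `S b` comes from the Hilbert–Schmidt pairing, as `S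
b` is not known to be self-adjoint here. -/
theorem algTrace_map_nonneg {A : Alg n} {B : Alg m} {S : B →ₗ[ℂ] A}
    (hS : IsUnitalSchwarz (hsAdjoint S)) {b : B} (hb : (b : Mat m).PosSemidef) (c : A) :
    0 ≤ algTrace A (star c * star (S b) * c) := by
  have h := hS.schwarz (star c)
  rw [star_star] at h
  have h' := h.add (coe_posSemidef_star_mul_self (hsAdjoint S (star c)))
  rw [AddSubgroupClass.coe_sub, sub_add_cancel] at h'
  have h'' := algTrace_mul_nonneg hb h'
  have e := hsAdjoint_spec S b (c * star c)
  rw [algTrace_mul_comm, ← mul_assoc, algTrace_mul_comm, algTrace_apply]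
  refine h''.trans_eq ?_
  rw [algTrace_apply]
  nth_rewrite 1 [show b = star b from Subtype.ext hb.1.symm]
  exact e.symm

/-- In blocks relative to `p`, with `v = p σ p` and `w = (1 - p) σ p`, the tested element is `v + l
(w + w*)`. Its lower corner is zero, so positivity forces `w = 0`. -/
theorem commute_of_forall_nonneg {A : Alg n} {σ p : A} {l : ℝ} (hσ : star σ = σ)
    (hp : IsStarProjection p) (hl : algTrace A (p * σ) = l) (h0 : 0 < l)
    (h : ∀ c : A, 0 ≤ algTrace A
      (star c * ((l : ℂ) • (p * σ + σ * p) + (1 - 2 * l : ℂ) • (p * σ * p)) * c)) :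
    σ * p = p * σ := by
  have hi := hp.isIdempotentElem.eq
  have hs := hp.isSelfAdjoint.star_eq
  set w := (1 - p) * σ * p with hw
  set v := p * σ * p with hv
  have hws : star w = p * σ * (1 - p) := by
    simp [hw, hs, hσ, mul_assoc]
  have e1 : σ * p = v + w := by rw [hv, hw, ← add_mul, ← add_mul, add_sub_cancel, one_mul]
  have e2 : p * σ = v + star w := by rw [hws, hv, ← mul_add, add_sub_cancel, mul_one]
  have hpq : p * (1 - p) = 0 := by rw [mul_sub, hi, mul_one, sub_self]
  have hqp : (1 - p) * p = 0 := by rw [sub_mul, hi, one_mul, sub_self]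
  have pw : p * w = 0 := by rw [hw, ← mul_assoc, ← mul_assoc, hpq, zero_mul, zero_mul]
  have wp : w * p = w := by rw [hw, mul_assoc, hi]
  have vp : v * p = v := by rw [hv, mul_assoc, hi]
  have pv : p * v = v := by rw [hv, ← mul_assoc, ← mul_assoc, hi]
  have psw : p * star w = star w := by rw [hws, ← mul_assoc, ← mul_assoc, hi]
  have swp : star w * p = 0 := by rw [hws, mul_assoc, hqp, mul_zero]
  have vw : v * w = 0 := by rw [← vp, mul_assoc, pw, mul_zero]
  have ww : w * w = 0 := by rw [← wp, mul_assoc, wp, pw, mul_zero]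
  have sww : star w * star w = 0 := by rw [← star_mul, ww, star_zero]
  have swv : star w * v = 0 := by rw [← pv, ← mul_assoc, swp, zero_mul]
  have key (ε : ℝ) : star ((ε : ℂ) • p - w) *
      ((l : ℂ) • (p * σ + σ * p) + (1 - 2 * l : ℂ) • v) * ((ε : ℂ) • p - w) =
      ((ε : ℂ) ^ 2) • v - (2 * ε * l : ℂ) • (star w * w) := by
    have e : (l : ℂ) • (p * σ + σ * p) + (1 - 2 * l : ℂ) • v = v + (l : ℂ) • (w + star w) := by
      rw [e1, e2]
      module
    rw [e]
    have hε : star (ε : ℂ) = ε := Complex.conj_ofReal ε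
    have f : (v + (l : ℂ) • (w + star w)) * ((ε : ℂ) • p - w) =
        (ε : ℂ) • v + (ε * l : ℂ) • w - (l : ℂ) • (star w * w) := by
      simp only [add_mul, mul_sub, smul_mul_assoc, mul_smul_comm, vp, wp, swp, vw, ww, smul_add,
        smul_zero, smul_smul, add_zero, zero_add]
    rw [mul_assoc, f, star_sub, star_smul, hε, hs]
    simp only [sub_mul, mul_add, mul_sub, smul_mul_assoc, mul_smul_comm, pv, pw, swv,
      ← mul_assoc, psw, sww, zero_mul, smul_zero]
    module
  have tv : algTrace A v = l := by
    rw [hv, algTrace_mul_comm, ← mul_assoc, hi, hl]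
  obtain ⟨r, hr0, hr⟩ : ∃ r : ℝ, 0 ≤ r ∧ algTrace A (star w * w) = r := by
    have := Complex.nonneg_iff.1 (coe_posSemidef_star_mul_self w).trace_nonneg
    exact ⟨_, this.1, Complex.ext rfl this.2.symm⟩
  -- For `c = ε p - w` the trace is `ε² l - 2 ε l r`, with `r = Tr w* w`. The choice `ε = r` gives
  -- `-l r²`.
  have hineq := h ((r : ℂ) • p - w)
  rw [key, map_sub, map_smul, map_smul, tv, hr, smul_eq_mul, smul_eq_mul] at hineq
  have hineq' : 0 ≤ r ^ 2 * l - 2 * r * l * r := by exact_mod_cast hineq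
  have hr2 : r = 0 := by
    by_contra hne
    have : 0 < r ^ 2 * l := by positivity
    linarith
  have hw0 : w = 0 := eq_zero_of_algTrace_star_mul_self (by rw [hr, hr2, Complex.ofReal_zero])
  rw [e1, e2, hw0, star_zero]

theorem not_reversible {A : Alg n} {σ p : A} {l : ℝ} {T : A →ₗ[ℂ] genBy p}
    (hT : IsTracePreservingCondExp (genBy_le p) T) (hσ : IsDensity σ) (hp : IsStarProjection p)
    (hne : σ * p ≠ p * σ) (hl : algTrace A (p * σ) = l) (h0 : 0 < l) (h1 : l < 1)
    (h2 : l ≠ 1 / 2) : ¬ Reversible T {σ, exRho σ p l} := by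
  rintro ⟨S, hS, hrec⟩
  apply hne
  have hσs : star σ = σ := Subtype.ext hσ.pos.1
  have hi := hp.isIdempotentElem.eq
  have hg := isStarProjection_gen hp
  have r1 : S (T σ) = σ := hrec σ (Or.inl rfl)
  have r2 : S (T (exRho σ p l)) = exRho σ p l := hrec _ (Or.inr rfl)
  have hc : (((l * (1 - l))⁻¹ : ℝ) : ℂ) ≠ 0 := by
    exact_mod_cast inv_ne_zero (mul_ne_zero h0.ne' (sub_ne_zero.2 h1.ne'))
  have h2' : (1 - 2 * l : ℂ) ≠ 0 := by
    have : 1 - 2 * l ≠ 0 := fun h => h2 (by linarith)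
    exact_mod_cast this
  rw [hT.map_exRho hp h0.ne' h1.ne, exRho_eq hi h0.ne' h1.ne,
    exRho_eq hg.isIdempotentElem.eq h0.ne' h1.ne, map_smul, smul_right_inj hc] at r2
  -- Writing `x = l + (1 - 2 l) q` expands `x a x`. Applied upstairs and downstairs, the `l² a`
  -- terms match under `S`, and the factor `1 - 2 l ≠ 0` cancels.
  have ex {R : Type} [Ring R] [Algebra ℂ R] (a q : R) :
      projComb q (1 - l) l * a * projComb q (1 - l) l = ((l : ℂ) ^ 2) • a +
        (1 - 2 * l : ℂ) • ((l : ℂ) • (q * a + a * q) + (1 - 2 * l : ℂ) • (q * a * q)) := by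
    have e : projComb q (1 - l : ℂ) l = (l : ℂ) • 1 + (1 - 2 * l : ℂ) • q := by
      simp only [projComb]
      module
    rw [e]
    simp only [add_mul, mul_add, smul_mul_assoc, mul_smul_comm, one_mul, mul_one]
    module
  rw [exX_eq, exX_eq, ex, ex, map_add, map_smul, r1, add_right_inj, map_smul,
    smul_right_inj h2'] at r2
  refine commute_of_forall_nonneg hσs hp hl h0 fun c => ?_
  have hb : (((l : ℂ) • (genBy.gen p * T σ + T σ * genBy.gen p) +
      (1 - 2 * l : ℂ) • (genBy.gen p * T σ * genBy.gen p) : genBy p) : Mat n).PosSemidef := by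
    -- Downstairs `p` commutes with `T σ`, so the coefficients add up to `2 l + (1 - 2 l) = 1`.
    have e : (l : ℂ) • (genBy.gen p * T σ + T σ * genBy.gen p) +
        (1 - 2 * l : ℂ) • (genBy.gen p * T σ * genBy.gen p) =
        star (genBy.gen p) * T σ * genBy.gen p := by
      rw [hg.isSelfAdjoint.star_eq, genBy_mul_comm hp _ (T σ), mul_assoc,
        hg.isIdempotentElem.eq]
      module
    rw [e]
    exact PosSemidef.coe_conj (hT.pos σ hσ.pos) _
  have h := algTrace_map_nonneg hS hb c
  rw [r2] at h
  have hy : star ((l : ℂ) • (p * σ + σ * p) + (1 - 2 * l : ℂ) • (p * σ * p)) =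
      (l : ℂ) • (p * σ + σ * p) + (1 - 2 * l : ℂ) • (p * σ * p) := by
    simp only [star_add, star_smul, star_mul, hσs, hp.isSelfAdjoint.star_eq, star_sub, star_one,
      ← mul_assoc]
    simp [add_comm, mul_comm]
  rwa [hy] at h

/-! ### Noncommuting pairs in full matrix algebras -/

/-- Take `σ = (1 + v v*) / (n + 5)` with `v = e₀ + 2 e₁` and `p` the projection onto `e₀`, so `l = 2
/ (n + 5)`. The unequal entries matter: `v = e₀ + e₁` would give `l = 2 / (n + 2)`, which is `1/2`
for `n = 2`. -/
theorem exists_noncommuting_pair (n : ℕ) (hn : 2 ≤ n) :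
    ∃ (σ p : (⊤ : Alg n)) (l : ℝ), IsDensity σ ∧ IsUnit σ ∧ IsStarProjection p ∧
      σ * p ≠ p * σ ∧ ((p * σ : (⊤ : Alg n)) : Mat n).trace = (l : ℂ) ∧ l ≠ 1 / 2 := by
  let i : Fin n := ⟨0, by omega⟩
  let j : Fin n := ⟨1, by omega⟩
  have hij : i ≠ j := by simp [i, j]
  let v : Fin n → ℂ := Pi.single i 1 + Pi.single j 2
  have vi : v i = 1 := by simp [v, hij]
  have vj : v j = 2 := by simp [v, hij.symm]
  let c : ℝ := ((n : ℝ) + 5)⁻¹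
  have hc : 0 < c := by positivity
  let s : Mat n := (c : ℂ) • (1 + Matrix.vecMulVec v (star v))
  let q : Mat n := Matrix.single i i 1
  have hs : s.PosDef :=
    (Matrix.PosDef.one.add_posSemidef (Matrix.posSemidef_vecMulVec_self_star v)).smul
      (by exact_mod_cast hc)
  refine ⟨⟨s, trivial⟩, ⟨q, trivial⟩, c * 2, ⟨hs.posSemidef, ?_⟩, ?_, ⟨?_, ?_⟩, fun h => ?_, ?_, ?_⟩
  · have e : v ⬝ᵥ star v = 5 := by
      simp [v, dotProduct_add, hij, hij.symm]
      norm_num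
    change Matrix.trace ((c : ℂ) • (1 + Matrix.vecMulVec v (star v))) = 1
    rw [Matrix.trace_smul, Matrix.trace_add, Matrix.trace_one, Matrix.trace_vecMulVec, e,
      Fintype.card_fin, smul_eq_mul]
    have : (n : ℂ) + 5 ≠ 0 := by exact_mod_cast (by omega : n + 5 ≠ 0)
    simp only [c]
    push_cast
    exact inv_mul_cancel₀ this
  · obtain ⟨u, hu⟩ := hs.isUnit
    exact ⟨⟨⟨s, trivial⟩, ⟨(u⁻¹ : (Mat n)ˣ), trivial⟩, Subtype.ext (by simp [← hu]),
      Subtype.ext (by simp [← hu])⟩, rfl⟩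
  · exact Subtype.ext (by simp [q])
  · exact Subtype.ext (by simp [q, Matrix.star_eq_conjTranspose])
  · have h' := congrArg (fun x : (⊤ : Alg n) => (x : Mat n) j i) h
    change (s * q) j i = (q * s) j i at h'
    simp [q, s, hij.symm, Matrix.vecMulVec_apply, vi, vj, hc.ne'] at h'
  · change (q * s).trace = _
    simp [q, s, Matrix.trace_single_mul, Matrix.vecMulVec_apply, vi]
    ring
  · have hn' : (2 : ℝ) ≤ n := by exact_mod_cast hn
    simp only [c]
    intro h
    field_simp at h
    linarith

/-! ### Preservation of the divergence without reversibility -/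

theorem construction_spec {n : ℕ} {A : Alg n} {σ p : A} {l : ℝ} (hσ : IsDensity σ)
    (hu : IsUnit σ) (hp : IsStarProjection p) (hne : σ * p ≠ p * σ)
    (hl : ((p * σ : A) : Mat n).trace = (l : ℂ)) (h2 : l ≠ 1 / 2) {T : A →ₗ[ℂ] genBy p}
    (hT : IsTracePreservingCondExp (genBy_le p) T) :
    (∀ b : genBy p, ((T σ * b : genBy p) : Mat n).trace = ((σ : Mat n) * b).trace) ∧
      0 < l ∧ l < 1 ∧ IsUnit (1 - exX p l) ∧
      exRho σ p l = (((l * (1 - l))⁻¹ : ℝ) : ℂ) • (exX p l * σ * exX p l) ∧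
      T (exRho σ p l) =
        Ring.inverse (1 - exX (genBy.gen p) l) * T σ * exX (genBy.gen p) l ∧
      ReversibilitySetting T {σ, exRho σ p l} (exRho σ p l) ∧
      Ring.inverse (leftAddRight σ (exRho σ p l)) (exRho σ p l) = exX p l ∧
      IsUnit (leftAddRight (T σ) (T (exRho σ p l))) ∧
      Ring.inverse (leftAddRight (T σ) (T (exRho σ p l))) (T (exRho σ p l)) =
        exX (genBy.gen p) l ∧
      fDivergence exF (T σ) (T (exRho σ p l)) = fDivergence exF σ (exRho σ p l) ∧
      ¬ Reversible T {σ, exRho σ p l} := by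
  obtain ⟨h0, h1⟩ := trace_projection_mem_Ioo hσ hu hp hne hl
  have hi := hp.isIdempotentElem.eq
  have hg := isStarProjection_gen hp
  have hp0 := ne_zero_of_not_commute hne
  have hp1 := ne_one_of_not_commute hne
  have hρ : IsDensity (exRho σ p l) := isDensity_exRho hσ hp hl h0 h1
  have hx := isUnit_one_sub_exX hi h0.ne' h1.ne
  have hρu : IsUnit (exRho σ p l) := (hx.ringInverse.mul hu).mul (isUnit_exX hi h0.ne' h1.ne)
  have hTρ := hT.map_exRho (σ := σ) hp h0.ne' h1.ne
  have hTρu := hT.isUnit_map hρ.pos hρu hp hp0 hp1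
  have hTσd := hT.map_isDensity hσ
  have hTρd := hT.map_isDensity hρ
  have hL := isUnit_leftAddRight hσ.pos hρ.pos hρu
  have hLT := isUnit_leftAddRight hTσd.pos hTρd.pos hTρu
  have hv := inverse_leftAddRight_eq hL (leftAddRight_exX (σ := σ) hx)
  have hvT : Ring.inverse (leftAddRight (T σ) (T (exRho σ p l))) (T (exRho σ p l)) =
      exX (genBy.gen p) l := by
    refine inverse_leftAddRight_eq hLT ?_
    rw [hTρ]
    exact leftAddRight_exX (isUnit_one_sub_exX hg.isIdempotentElem.eq h0.ne' h1.ne)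
  refine ⟨hT.algTrace_mul σ, h0, h1, hx, exRho_eq hi h0.ne' h1.ne, hTρ,
    ⟨?_, Or.inr rfl, hρu, hTρu, hT.isUnitalSchwarz_hsAdjoint,
      hT.isUnitalSchwarz_dualMap hρ.pos hρu hp hTρu⟩, hv, hLT, hvT, ?_,
    not_reversible hT hσ hp hne hl h0 h1 h2⟩
  · rintro τ (rfl | rfl)
    exacts [hσ, hρ]
  · have e1 := fDivergence_exF hσ.pos hρ.pos hρu
    have e2 := fDivergence_exF hTσd.pos hTρd.pos hTρu
    rw [hv] at e1
    rw [hvT] at e2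
    refine Complex.ofReal_injective (e2.trans (Eq.trans ?_ e1.symm))
    -- Both divergences are now pairings with the same `x`, which lies in the small algebra.
    exact hT.algTrace_mul _ _

/-- The value is `f(1)`. It settles the case `τ = ρ` when equality is needed on all of `{σ, ρ}`. -/
theorem fDivergence_exF_self {n : ℕ} {A : Alg n} {ρ : A} (hρ : IsDensity ρ) (hu : IsUnit ρ) :
    fDivergence exF ρ ρ = 1 / 2 := by
  have e := fDivergence_exF hρ.pos hρ.pos hu
  have hx : leftAddRight ρ ρ ((1 / 2 : ℂ) • 1) = ρ := by
    rw [leftAddRight_apply, mul_smul_comm, smul_mul_assoc, mul_one, one_mul]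
    module
  rw [inverse_leftAddRight_eq (isUnit_leftAddRight hρ.pos hρ.pos hu) hx, mul_smul_comm,
    mul_one, ← algTrace_apply, map_smul, algTrace_apply, hρ.trace_eq, smul_eq_mul, mul_one] at e
  refine Complex.ofReal_injective (e.trans ?_)
  norm_num

end QRev

theorem mainTheorem10 :
    -- the function and its representing measure
    StrictlyOperatorConvex exF ∧
    (∀ μ : MeasureTheory.Measure ℝ,
      IsRepresentingMeasure exF μ ↔ μ = MeasureTheory.Measure.dirac 1) ∧
    -- the explicit form of the divergence
    (∀ (n : ℕ) (A : Alg n) (σ ρ : A), IsDensity σ → IsDensity ρ → IsUnit ρ →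
      IsUnit (leftAddRight σ ρ) ∧
      (fDivergence exF σ ρ : ℂ) =
        ((ρ * Ring.inverse (leftAddRight σ ρ) ρ : A) : Mat n).trace) ∧
    -- the construction
    (∀ (n : ℕ) (A : Alg n) (σ p : A) (l : ℝ), IsDensity σ → IsUnit σ → IsStarProjection p →
      σ * p ≠ p * σ → ((p * σ : A) : Mat n).trace = (l : ℂ) → l ≠ 1 / 2 →
      (∀ b c : genBy p, b * c = c * b) ∧
      (∃! T : A →ₗ[ℂ] genBy p, IsTracePreservingCondExp (genBy_le p) T) ∧
      ∀ T : A →ₗ[ℂ] genBy p, IsTracePreservingCondExp (genBy_le p) T →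
        (∀ b : genBy p, ((T σ * b : genBy p) : Mat n).trace = ((σ : Mat n) * b).trace) ∧
        0 < l ∧ l < 1 ∧ IsUnit (1 - exX p l) ∧
        exRho σ p l = (((l * (1 - l))⁻¹ : ℝ) : ℂ) • (exX p l * σ * exX p l) ∧
        T (exRho σ p l) =
          Ring.inverse (1 - exX (genBy.gen p) l) * T σ * exX (genBy.gen p) l ∧
        ReversibilitySetting T {σ, exRho σ p l} (exRho σ p l) ∧
        Ring.inverse (leftAddRight σ (exRho σ p l)) (exRho σ p l) = exX p l ∧
        IsUnit (leftAddRight (T σ) (T (exRho σ p l))) ∧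
        Ring.inverse (leftAddRight (T σ) (T (exRho σ p l))) (T (exRho σ p l)) =
          exX (genBy.gen p) l ∧
        fDivergence exF (T σ) (T (exRho σ p l)) = fDivergence exF σ (exRho σ p l) ∧
        ¬ Reversible T {σ, exRho σ p l}) ∧
    -- the construction applies to every noncommutative full matrix algebra
    (∀ n : ℕ, 2 ≤ n → ∃ (σ p : (⊤ : Alg n)) (l : ℝ), IsDensity σ ∧ IsUnit σ ∧
      IsStarProjection p ∧ σ * p ≠ p * σ ∧ ((p * σ : (⊤ : Alg n)) : Mat n).trace = (l : ℂ) ∧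
      l ≠ 1 / 2) ∧
    -- preservation of this divergence does not imply reversibility
    ¬ (∀ (n m : ℕ) (A : Alg n) (B : Alg m) (T : A →ₗ[ℂ] B) (𝒮 : Set A) (ρ : A),
        ReversibilitySetting T 𝒮 ρ →
        (∀ τ ∈ 𝒮, fDivergence exF (T τ) (T ρ) = fDivergence exF τ ρ) → Reversible T 𝒮) := by
  refine ⟨strictlyOperatorConvex_exF, isRepresentingMeasure_exF_iff, ?_, ?_,
    exists_noncommuting_pair, fun H => ?_⟩
  · exact fun n A σ ρ hσ hρ hu =>
      ⟨isUnit_leftAddRight hσ.pos hρ.pos hu, fDivergence_exF hσ.pos hρ.pos hu⟩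
  · intro n A σ p l hσ hu hp hne hl h2
    exact ⟨genBy_mul_comm hp,
      existsUnique_condExp hp (ne_zero_of_not_commute hne) (ne_one_of_not_commute hne),
      fun T hT => construction_spec hσ hu hp hne hl h2 hT⟩
  · obtain ⟨σ, p, l, hσ, hu, hp, hne, hl, h2⟩ := exists_noncommuting_pair 2 le_rfl
    obtain ⟨T, hT, -⟩ :=
      existsUnique_condExp hp (ne_zero_of_not_commute hne) (ne_one_of_not_commute hne)
    obtain ⟨-, -, -, -, -, -, hC, -, -, -, hS, hrev⟩ :=
      construction_spec hσ hu hp hne hl h2 hT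
    refine hrev (H 2 2 ⊤ (genBy p) T _ _ hC ?_)
    rintro τ (rfl | rfl)
    · exact hS
    · have hρ := hC.density _ hC.mem
      rw [fDivergence_exF_self hρ hC.isUnit,
        fDivergence_exF_self (hT.map_isDensity hρ) hC.isUnit_map]
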